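/- For a measurable $f:\mathbb{R}_+\to\mathbb{C}$, $\mathbb{R}_+=(0,\infty)$, let $\lambda_f(t)=|\{x\in\mathbb{R}_+:|f(x)|>t\}|$ ($t>0$) be its distribution function with respect to Lebesgue measure, and for $0<r<\infty$ let $L_{r,w}(\mathbb{R}_+)$ be the weak Lebesgue space of all measurable $f$ with $\|f\|_{r,w}=\sup_{t>0}\bigl(t^{r}\lambda_f(t)\bigr)^{1/r}<\infty$. For $1<p<\infty$ and a complex-valued potential $q$ let $H=-\frac{d^2}{dx^2}+q$ be the Schr\"odinger operator in $L_p(\mathbb{R}_+)$ with Dirichlet boundary condition: its domain consists of all $u\in L_p(\mathbb{R}_+)$ such that $u$ and $u'$ are absolutely continuous on every interval $[0,R]$, $u(0)=0$ and $-u''+qu\in L_p(\mathbb{R}_+)$, and $Hu=-u''+qu$. Let $1<p<\infty$, and let $\gamma\in\mathbb{R}$ satisfy $2\gamma>1$ if $1<p\le 2$, and $2\gamma>p-1$ if $p>2$. Then for every $\theta\in(0,2\pi)$ there is a constant $C=C(p,\gamma,\theta)>0$, depending only on $p$, $\gamma$ and $\theta$, such that for every $q\in L_{\gamma+1/2,w}(\mathbb{R}_+)$,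 every eigenvalue $\lambda=|\lambda|e^{i\theta}\in\mathbb{C}\setminus[0,\infty)$ of the operator $H$ in $L_p(\mathbb{R}_+)$ satisfies $$|\lambda|^{\gamma}\le C\,\sup_{t>0}\bigl(t^{\gamma+1/2}\lambda_q(t)\bigr).$$ -/

import Mathlib

open MeasureTheory Set Filter Topology
open scoped ENNReal

/-- Lebesgue measure on the half-line `ℝ₊ = (0, ∞)`. -/
noncomputable abbrev halfLine : Measure ℝ := volume.restrict (Ioi 0)

/-- The distribution function `λ_f(t) = |{x ∈ ℝ₊ : |f(x)| > t}|`. -/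
noncomputable def distribFun (f : ℝ → ℂ) (t : ℝ) : ℝ≥0∞ :=
  halfLine {x | t < ‖f x‖}

/-- The weak quasi-norm `‖f‖_{r,w} = sup_{t > 0} (t ^ r λ_f(t)) ^ (1 / r)`. -/
noncomputable def weakNorm (r : ℝ) (f : ℝ → ℂ) : ℝ≥0∞ :=
  ⨆ (t : ℝ) (_ : 0 < t), (ENNReal.ofReal t ^ r * distribFun f t) ^ (1 / r)

/-- Membership in the weak Lebesgue space `L_{r,w}(ℝ₊)`, for `0 < r < ∞`. -/
def MemWeakL (r : ℝ) (f : ℝ → ℂ) : Prop :=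
  AEStronglyMeasurable f halfLine ∧ weakNorm r f < ∞

/-- `φ` and its derivative `ψ` are absolutely continuous on every `[0, R]`, `φ 0 = 0`, and
`-φ'' + q φ = f` almost everywhere on `ℝ₊`. -/
structure IsDirichletSolution (q f φ ψ : ℝ → ℂ) : Prop where
  boundary : φ 0 = 0
  hasDeriv : ∀ x, 0 ≤ x → HasDerivWithinAt φ (ψ x) (Ici 0) x
  absCont : ∀ R, 0 < R → AbsolutelyContinuousOnInterval ψ 0 R
  equation : ∀ᵐ x ∂halfLine, HasDerivAt ψ (q x * φ x - f x) x

/-- The graph of the Dirichlet realization of `-d²/dx² + q` in `L_p(ℝ₊)`: the pairs `(u, f)` with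
`u, f ∈ L_p(ℝ₊)`, `u, u'` locally absolutely continuous on `[0, ∞)`, `u(0) = 0` and
`-u'' + q u = f`. -/
def schrodingerGraph (p : ℝ) (q : ℝ → ℂ) :
    Submodule ℂ (Lp ℂ (ENNReal.ofReal p) halfLine × Lp ℂ (ENNReal.ofReal p) halfLine) where
  carrier := {w | ∃ φ ψ : ℝ → ℂ, w.1 =ᵐ[halfLine] φ ∧ IsDirichletSolution q w.2 φ ψ}
  zero_mem' := by
    refine ⟨fun _ => 0, fun _ => 0, Lp.coeFn_zero _ _ _, rfl, fun x _ => ?_, fun R _ => ?_, ?_⟩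
    · exact hasDerivWithinAt_const _ _ _
    · exact (LipschitzWith.const (0 : ℂ)).lipschitzOnWith.absolutelyContinuousOnInterval
    · filter_upwards [Lp.coeFn_zero ℂ (ENNReal.ofReal p) halfLine] with x hx
      have : ((0 : Lp ℂ (ENNReal.ofReal p) halfLine ×
          Lp ℂ (ENNReal.ofReal p) halfLine).2 : ℝ → ℂ) x = 0 := hx
      rw [this]
      simpa using hasDerivAt_const x (0 : ℂ)
  add_mem' := by
    rintro ⟨u, f⟩ ⟨v, g⟩ ⟨φ, ψ, h1, h2⟩ ⟨φ', ψ', h1', h2'⟩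
    refine ⟨fun x => φ x + φ' x, fun x => ψ x + ψ' x, ?_, ?_, fun x hx => ?_, fun R hR => ?_, ?_⟩
    · filter_upwards [h1, h1', Lp.coeFn_add u v] with x a b c
      simp only [Prod.mk_add_mk] at *
      rw [c, Pi.add_apply, a, b]
    · simp [h2.boundary, h2'.boundary]
    · exact (h2.hasDeriv x hx).add (h2'.hasDeriv x hx)
    · exact (h2.absCont R hR).add (h2'.absCont R hR)
    · filter_upwards [h2.equation, h2'.equation, Lp.coeFn_add f g] with x a b c
      simp only [Prod.mk_add_mk] at *
      rw [c, Pi.add_apply]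
      exact (a.add b).congr_deriv (by ring)
  smul_mem' := by
    rintro c ⟨u, f⟩ ⟨φ, ψ, h1, h2⟩
    refine ⟨fun x => c * φ x, fun x => c * ψ x, ?_, ?_, fun x hx => ?_, fun R hR => ?_, ?_⟩
    · filter_upwards [h1, Lp.coeFn_smul c u] with x a b
      simp only [Prod.smul_mk] at *
      rw [b, Pi.smul_apply, a, smul_eq_mul]
    · simp [h2.boundary]
    · exact (h2.hasDeriv x hx).const_mul c
    · exact (h2.absCont R hR).const_smul c
    · filter_upwards [h2.equation, Lp.coeFn_smul c f] with x a b
      simp only [Prod.smul_mk] at *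
      rw [b, Pi.smul_apply, smul_eq_mul]
      exact (a.const_mul c).congr_deriv (by ring)

/-- The graph is single-valued, so that it is the graph of an operator. -/
theorem schrodingerGraph_single_valued (p : ℝ) (q : ℝ → ℂ)
    (w : Lp ℂ (ENNReal.ofReal p) halfLine × Lp ℂ (ENNReal.ofReal p) halfLine)
    (hw : w ∈ schrodingerGraph p q) (h0 : w.1 = 0) : w.2 = 0 := by
  obtain ⟨φ, ψ, h1, h2⟩ := hw
  have hae : φ =ᵐ[halfLine] fun _ => 0 := by
    rw [h0] at h1
    exact h1.symm.trans (Lp.coeFn_zero _ _ _)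
  have hcont : ContinuousOn φ (Ici 0) := fun x hx => (h2.hasDeriv x hx).continuousWithinAt
  have hφ : EqOn φ (fun _ => 0) (Ioi 0) :=
    Measure.eqOn_open_of_ae_eq hae isOpen_Ioi (hcont.mono Ioi_subset_Ici_self)
      continuousOn_const
  have hψ : ∀ x, 0 < x → ψ x = 0 := by
    intro x hx
    have hd : HasDerivAt φ (ψ x) x := (h2.hasDeriv x hx.le).hasDerivAt (Ici_mem_nhds hx)
    have he : φ =ᶠ[𝓝 x] fun _ => 0 := hφ.eventuallyEq_of_mem (Ioi_mem_nhds hx)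
    exact (hd.congr_of_eventuallyEq he.symm).unique (hasDerivAt_const x 0)
  apply (Lp.eq_zero_iff_ae_eq_zero).2
  filter_upwards [h2.equation, ae_restrict_mem measurableSet_Ioi] with x hx hx0
  have he : ψ =ᶠ[𝓝 x] fun _ => 0 :=
    (show EqOn ψ (fun _ => 0) (Ioi 0) from hψ).eventuallyEq_of_mem (Ioi_mem_nhds hx0)
  have := (hx.congr_of_eventuallyEq he.symm).unique (hasDerivAt_const x 0)
  rw [hφ hx0, mul_zero, zero_sub, neg_eq_zero] at this
  exact this

/-- The Schrödinger operator `H = -d²/dx² + q` in `L_p(ℝ₊)` with the Dirichlet condition at `0`. -/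
noncomputable def schrodingerOp (p : ℝ) (q : ℝ → ℂ) :
    Lp ℂ (ENNReal.ofReal p) halfLine →ₗ.[ℂ] Lp ℂ (ENNReal.ofReal p) halfLine :=
  (schrodingerGraph p q).toLinearPMap

theorem schrodingerOp_graph (p : ℝ) (q : ℝ → ℂ) :
    (schrodingerOp p q).graph = schrodingerGraph p q :=
  Submodule.toLinearPMap_graph_eq _ (schrodingerGraph_single_valued p q)

/-- `lam` is an eigenvalue of the (unbounded) operator `T`. -/
def IsEigenvalue {E : Type*} [AddCommGroup E] [Module ℂ E] (T : E →ₗ.[ℂ] E) (lam : ℂ) : Prop :=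
  ∃ u : T.domain, (u : E) ≠ 0 ∧ T u = lam • (u : E)

/-! A Birman–Schwinger argument in the sup norm. Let `k ^ 2 = lam` with `κ = k.im > 0`. The free
Dirichlet Green kernel is bounded by `‖k‖⁻¹ exp (-κ|x - y|)`, so an eigenfunction `φ` satisfies `|φ|
≤ ‖k‖⁻¹ ∫ exp (-κ|x - y|) |q| |φ|` up to a boundary term at `R` (`norm_le_integral_exp`). A
weak-type `q` is uniformly locally integrable, which forces an `L_p` solution and its derivative to
be bounded (`exists_bound_of_memLp`); the boundary term then vanishes as `R → ∞`, and dividing by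
`sup |φ|` gives `1 ≤ ‖k‖⁻¹ sup_x ∫ exp (-κ|x - y|) |q|` with the integral replaced by any upper
bound (`one_le_of_memLp`).

That bound comes from `|q| ≤ t + (|q| - t)₊`: the first part contributes `2t/κ`, the second at most
`N t ^ (1 - r) / (r - 1)`, where `r = γ + 1/2 > 1` and `N` is the weak-type supremum. Taking `t` a
small multiple of `|lam|` makes the first part equal to `1/2` and leaves the claimed inequality. -/

/-! ### Calculus of complex absolutely continuous functions. -/

theorem LipschitzWith.comp_absolutelyContinuousOnInterval {X Y : Type*} [PseudoMetricSpace X]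
    [PseudoMetricSpace Y] {g : X → Y} (hg : LipschitzWith 1 g) {f : ℝ → X} {a b : ℝ}
    (hf : AbsolutelyContinuousOnInterval f a b) :
    AbsolutelyContinuousOnInterval (fun x => g (f x)) a b := by
  refine squeeze_zero (fun t => Finset.sum_nonneg fun i _ => dist_nonneg) (fun t => ?_) hf
  exact Finset.sum_le_sum fun i _ => by simpa using hg.dist_le_mul _ _

/-- The fundamental theorem of calculus for complex absolutely continuous functions. -/
theorem AbsolutelyContinuousOnInterval.integral_eq_sub_of_ae_hasDerivAt {F F' : ℝ → ℂ} {a b : ℝ}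
    (hab : a ≤ b) (hF : AbsolutelyContinuousOnInterval F a b)
    (hd : ∀ᵐ x, x ∈ Ioo a b → HasDerivAt F (F' x) x) :
    IntervalIntegrable F' volume a b ∧ ∫ x in a..b, F' x = F b - F a := by
  have hre : AbsolutelyContinuousOnInterval (fun x => (F x).re) a b :=
    LipschitzWith.comp_absolutelyContinuousOnInterval
      (LipschitzWith.of_dist_le_mul fun x y => by
        simpa [Complex.dist_eq, Real.dist_eq] using Complex.abs_re_le_norm (x - y)) hF
  have him : AbsolutelyContinuousOnInterval (fun x => (F x).im) a b :=
    LipschitzWith.comp_absolutelyContinuousOnInterval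
      (LipschitzWith.of_dist_le_mul fun x y => by
        simpa [Complex.dist_eq, Real.dist_eq] using Complex.abs_im_le_norm (x - y)) hF
  -- The derivative is known on the open interval only, while `uIoc a b` contains `b`.
  have hb : ∀ᵐ x : ℝ, x ≠ b := by simp [ae_iff]
  have key : ∀ᵐ x, x ∈ uIoc a b →
      ((deriv (fun x => (F x).re) x : ℝ) : ℂ) +
        ((deriv (fun x => (F x).im) x : ℝ) : ℂ) * Complex.I = F' x := by
    filter_upwards [hd, hb] with x hx hxb hxm
    rw [uIoc_of_le hab] at hxm
    have h := hx ⟨hxm.1, lt_of_le_of_ne hxm.2 hxb⟩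
    have h1 : HasDerivAt (fun x => (F x).re) (F' x).re x :=
      (Complex.reCLM.hasFDerivAt.comp_hasDerivAt x h)
    have h2 : HasDerivAt (fun x => (F x).im) (F' x).im x :=
      (Complex.imCLM.hasFDerivAt.comp_hasDerivAt x h)
    rw [h1.deriv, h2.deriv, Complex.re_add_im]
  have i1 := hre.intervalIntegrable_deriv
  have i2 := him.intervalIntegrable_deriv
  have j1 : IntervalIntegrable (fun x => ((deriv (fun x => (F x).re) x : ℝ) : ℂ)) volume a b :=
    ⟨i1.1.ofReal, i1.2.ofReal⟩
  have j2 : IntervalIntegrable (fun x => ((deriv (fun x => (F x).im) x : ℝ) : ℂ)) volume a b :=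
    ⟨i2.1.ofReal, i2.2.ofReal⟩
  constructor
  · exact (j1.add (j2.mul_const Complex.I)).congr_ae ((ae_restrict_iff' measurableSet_uIoc).2 key)
  · rw [← intervalIntegral.integral_congr_ae key, intervalIntegral.integral_add j1
      (j2.mul_const _), intervalIntegral.integral_mul_const, intervalIntegral.integral_ofReal,
      intervalIntegral.integral_ofReal, hre.integral_deriv_eq_sub, him.integral_deriv_eq_sub]
    apply Complex.ext <;> simp

/-! ### Integrals of weak-type potentials over the half-line. -/

section WeakType

variable {r N t : ℝ} {q : ℝ → ℂ}

/-- By the layer-cake formula the left side is `∫ distribFun q (s + t) ds` over `s > 0`, and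
`distribFun q s ≤ N s ^ (-r)` has a finite tail integral because `r > 1`. -/
theorem lintegral_norm_sub_le_of_weak (hr : 1 < r) (hN : 0 ≤ N)
    (hq : AEStronglyMeasurable q halfLine)
    (hw : ∀ s : ℝ, 0 < s → ENNReal.ofReal s ^ r * distribFun q s ≤ ENNReal.ofReal N)
    (ht : 0 < t) :
    ∫⁻ x, ENNReal.ofReal (‖q x‖ - t) ∂halfLine ≤
      ENNReal.ofReal (N * (t ^ (1 - r) / (r - 1))) := by
  have hd : ∀ s : ℝ, 0 < s → distribFun q s ≤ ENNReal.ofReal (N * s ^ (-r)) := by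
    intro s hs
    have h1 : ENNReal.ofReal s ^ r ≠ 0 := by
      rw [ENNReal.ofReal_rpow_of_pos hs]; simp [Real.rpow_pos_of_pos hs]
    have h2 : ENNReal.ofReal s ^ r ≠ ∞ := by
      rw [ENNReal.ofReal_rpow_of_pos hs]; simp
    rw [Real.rpow_neg hs.le, ← div_eq_mul_inv, ENNReal.ofReal_div_of_pos (Real.rpow_pos_of_pos hs r),
      ← ENNReal.ofReal_rpow_of_pos hs, ENNReal.le_div_iff_mul_le (Or.inl h1) (Or.inl h2), mul_comm]
    exact hw s hs
  have hmax : ∀ x, ENNReal.ofReal (‖q x‖ - t) = ENNReal.ofReal (max (‖q x‖ - t) 0) := by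
    intro x; rw [ENNReal.ofReal_max]; simp
  simp_rw [hmax]
  rw [lintegral_eq_lintegral_meas_lt (f := fun x => max (‖q x‖ - t) 0) _ (ae_of_all _ fun x => le_max_right _ _)
    ((hq.norm.aemeasurable.sub_const t).max aemeasurable_const)]
  have hint : IntegrableOn (fun s : ℝ => (s + t) ^ (-r)) (Ioi 0) :=
    integrableOn_add_rpow_Ioi_of_lt (by linarith) (by linarith)
  calc ∫⁻ s in Ioi 0, halfLine {x | s < max (‖q x‖ - t) 0}
      ≤ ∫⁻ s in Ioi 0, ENNReal.ofReal (N * (s + t) ^ (-r)) := by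
        refine setLIntegral_mono_ae' measurableSet_Ioi (ae_of_all _ fun s hs => ?_)
        have hs : 0 < s := hs
        refine le_trans (measure_mono fun x hx => ?_) (hd (s + t) (by linarith))
        simp only [mem_ofPred_eq, lt_max_iff] at hx ⊢
        rcases hx with hx | hx <;> linarith
    _ = ENNReal.ofReal (∫ s in Ioi 0, N * (s + t) ^ (-r)) := by
        rw [ofReal_integral_eq_lintegral_ofReal (hint.const_mul N)]
        refine (ae_restrict_iff' measurableSet_Ioi).2 (ae_of_all _ fun s hs => ?_)
        have hs : 0 < s := hs
        exact mul_nonneg hN (Real.rpow_nonneg (by linarith) _)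
    _ = ENNReal.ofReal (N * (t ^ (1 - r) / (r - 1))) := by
        rw [integral_const_mul]
        have h := (measurePreserving_add_right volume t).setIntegral_preimage_emb
          (measurableEmbedding_addRight t) (fun s : ℝ => s ^ (-r)) (Ioi t)
        rw [preimage_add_const_Ioi, sub_self] at h
        rw [h, integral_Ioi_rpow_of_lt (by linarith) ht]
        congr 2
        rw [show -r + 1 = 1 - r by ring, show r - 1 = -(1 - r) by ring, div_neg, neg_div]

/-- Split `|q| ≤ t + (|q| - t)₊`; the weight is kept on the constant `t` and bounded by `1` on the
excess. -/
theorem lintegral_weight_mul_le_of_weak (hr : 1 < r) (hN : 0 ≤ N)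
    (hq : AEStronglyMeasurable q halfLine)
    (hw : ∀ s : ℝ, 0 < s → ENNReal.ofReal s ^ r * distribFun q s ≤ ENNReal.ofReal N)
    (ht : 0 < t) {w : ℝ → ℝ≥0∞} (hwm : Measurable w) (hw1 : ∀ x, w x ≤ 1) :
    ∫⁻ x, w x * ‖q x‖ₑ ∂halfLine ≤
      (∫⁻ x, w x) * ENNReal.ofReal t + ENNReal.ofReal (N * (t ^ (1 - r) / (r - 1))) := by
  calc ∫⁻ x, w x * ‖q x‖ₑ ∂halfLine
      ≤ ∫⁻ x, (w x * ENNReal.ofReal t + ENNReal.ofReal (‖q x‖ - t)) ∂halfLine := by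
        refine lintegral_mono fun x => ?_
        have h1 : ‖q x‖ₑ ≤ ENNReal.ofReal t + ENNReal.ofReal (‖q x‖ - t) := by
          rw [← ofReal_norm]
          calc ENNReal.ofReal ‖q x‖ = ENNReal.ofReal (t + (‖q x‖ - t)) := by ring_nf
            _ ≤ _ := ENNReal.ofReal_add_le
        calc w x * ‖q x‖ₑ ≤ w x * (ENNReal.ofReal t + ENNReal.ofReal (‖q x‖ - t)) := by gcongr
          _ = w x * ENNReal.ofReal t + w x * ENNReal.ofReal (‖q x‖ - t) := mul_add _ _ _
          _ ≤ w x * ENNReal.ofReal t + 1 * ENNReal.ofReal (‖q x‖ - t) := by gcongr; exact hw1 x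
          _ = _ := by rw [one_mul]
    _ = (∫⁻ x, w x ∂halfLine) * ENNReal.ofReal t + ∫⁻ x, ENNReal.ofReal (‖q x‖ - t) ∂halfLine := by
        rw [lintegral_add_left (hwm.mul_const _), lintegral_mul_const _ hwm]
    _ ≤ _ := by
        gcongr
        · exact Measure.restrict_le_self
        · exact lintegral_norm_sub_le_of_weak hr hN hq hw ht

theorem lintegral_exp_neg_mul_abs_sub {κ : ℝ} (hκ : 0 < κ) (x : ℝ) :
    ∫⁻ y, ENNReal.ofReal (Real.exp (-(κ * |x - y|))) = ENNReal.ofReal (2 / κ) := by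
  have h0 : ∫⁻ y, ENNReal.ofReal (Real.exp (-(κ * |x - y|)))
      = ∫⁻ y, ENNReal.ofReal (Real.exp (-(κ * |y|))) :=
    lintegral_sub_left_eq_self (fun y => ENNReal.ofReal (Real.exp (-(κ * |y|)))) x
  have h3 : ∫ y in Ioi (0 : ℝ), Real.exp (-κ * y) = 1 / κ := by
    rw [integral_exp_mul_Ioi (by linarith)]; simp
  have h5 : ∫ y, Real.exp (-(κ * |y|)) = 2 / κ := by
    rw [integral_comp_abs (f := fun y => Real.exp (-(κ * y)))]
    simp only [← neg_mul]
    rw [h3]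
    ring
  -- A nonintegrable function has Bochner integral `0`, contradicting the value in `h5`.
  have h4 : Integrable (fun y : ℝ => Real.exp (-(κ * |y|))) := by
    by_contra h
    rw [integral_undef h] at h5
    exact (by positivity : (2 / κ) ≠ 0) h5.symm
  rw [h0, ← ofReal_integral_eq_lintegral_ofReal h4 (ae_of_all _ fun _ => (Real.exp_pos _).le), h5]

end WeakType

/-! ### Solutions of the equation and their Green representation. -/

theorem absolutelyContinuousOnInterval_of_hasDerivWithinAt {f f' : ℝ → ℂ} {a b : ℝ} (hab : a ≤ b)
    (hf : ∀ x ∈ Icc a b, HasDerivWithinAt f (f' x) (Icc a b) x) (hf' : ContinuousOn f' (Icc a b)) :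
    AbsolutelyContinuousOnInterval f a b := by
  obtain ⟨C, hC⟩ := isCompact_Icc.exists_bound_of_continuousOn hf'
  have : LipschitzOnWith (Real.toNNReal C) f (Icc a b) :=
    (convex_Icc a b).lipschitzOnWith_of_nnnorm_hasDerivWithin_le hf fun x hx => by
      rw [← NNReal.coe_le_coe, coe_nnnorm]
      exact (hC x hx).trans (Real.le_coe_toNNReal C)
  rw [← uIcc_of_le hab] at this
  exact this.absolutelyContinuousOnInterval

/-- `φ` is differentiable on `[0, ∞)` with locally absolutely continuous derivative `ψ`, and
`φ'' = (q - lam) φ` almost everywhere on `ℝ₊`. -/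
structure SolvesSchrodinger (q : ℝ → ℂ) (lam : ℂ) (φ ψ : ℝ → ℂ) : Prop where
  hasDeriv : ∀ x, 0 ≤ x → HasDerivWithinAt φ (ψ x) (Ici 0) x
  absCont : ∀ R, 0 < R → AbsolutelyContinuousOnInterval ψ 0 R
  equation : ∀ᵐ x ∂halfLine, HasDerivAt ψ ((q x - lam) * φ x) x

namespace SolvesSchrodinger

variable {q φ ψ : ℝ → ℂ} {lam : ℂ}

theorem continuousOn (h : SolvesSchrodinger q lam φ ψ) : ContinuousOn φ (Ici 0) :=
  fun x hx => (h.hasDeriv x hx).continuousWithinAt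

theorem absolutelyContinuousOnInterval (h : SolvesSchrodinger q lam φ ψ) {a b : ℝ} (ha : 0 ≤ a)
    (hab : a ≤ b) : AbsolutelyContinuousOnInterval ψ a b := by
  refine (h.absCont (b + 1) (by linarith)).mono ?_
  rw [uIcc_of_le hab, uIcc_of_le (by linarith)]
  exact Icc_subset_Icc ha (by linarith)

theorem ae_hasDerivAt (h : SolvesSchrodinger q lam φ ψ) {a b : ℝ} (ha : 0 ≤ a) :
    ∀ᵐ x, x ∈ Ioo a b → HasDerivAt ψ ((q x - lam) * φ x) x := by
  filter_upwards [(ae_restrict_iff' measurableSet_Ioi).1 h.equation] with x hx hxm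
  exact hx (lt_of_le_of_lt ha hxm.1)

theorem integral_eq_sub (h : SolvesSchrodinger q lam φ ψ) {a b : ℝ} (ha : 0 ≤ a) (hab : a ≤ b) :
    ∫ x in a..b, (q x - lam) * φ x = ψ b - ψ a :=
  ((h.absolutelyContinuousOnInterval ha hab).integral_eq_sub_of_ae_hasDerivAt hab
    (h.ae_hasDerivAt ha)).2

/-- Lagrange's identity on `[a, b]`, against a solution `e` of the free equation. -/
theorem integral_mul_eq_wronskian (h : SolvesSchrodinger q lam φ ψ) {e e' : ℝ → ℂ}
    (he : ∀ x, HasDerivAt e (e' x) x) (he' : ∀ x, HasDerivAt e' (-lam * e x) x) {a b : ℝ}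
    (ha : 0 ≤ a) (hab : a ≤ b) :
    ∫ x in a..b, q x * φ x * e x =
      (φ a * e' a - ψ a * e a) - (φ b * e' b - ψ b * e b) := by
  have hsub : Icc a b ⊆ Ici 0 := fun x hx => ha.trans hx.1
  have hψ := h.absolutelyContinuousOnInterval ha hab
  have hφ : AbsolutelyContinuousOnInterval φ a b :=
    absolutelyContinuousOnInterval_of_hasDerivWithinAt hab
      (fun x hx => (h.hasDeriv x (hsub hx)).mono hsub) (by
        simpa [uIcc_of_le hab] using hψ.continuousOn)
  have hec : Continuous e := continuous_iff_continuousAt.2 fun x => (he x).continuousAt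
  have hec' : Continuous e' := continuous_iff_continuousAt.2 fun x => (he' x).continuousAt
  have heA := absolutelyContinuousOnInterval_of_hasDerivWithinAt hab
    (fun x _ => (he x).hasDerivWithinAt) hec'.continuousOn
  have heA' := absolutelyContinuousOnInterval_of_hasDerivWithinAt hab
    (fun x _ => (he' x).hasDerivWithinAt) (continuous_const.mul hec).continuousOn
  have hW : AbsolutelyContinuousOnInterval (fun x => ψ x * e x - φ x * e' x) a b :=
    (hψ.smul heA).sub (hφ.smul heA')
  have hd : ∀ᵐ x, x ∈ Ioo a b →
      HasDerivAt (fun x => ψ x * e x - φ x * e' x) (q x * φ x * e x) x := by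
    filter_upwards [h.ae_hasDerivAt (b := b) ha] with x hx hxm
    have h0 : 0 < x := lt_of_le_of_lt ha hxm.1
    have h1 : HasDerivAt φ (ψ x) x := (h.hasDeriv x h0.le).hasDerivAt (Ici_mem_nhds h0)
    exact (((hx hxm).mul (he x)).sub (h1.mul (he' x))).congr_deriv (by ring)
  rw [(hW.integral_eq_sub_of_ae_hasDerivAt hab hd).2]
  ring

/-- The boundary-value representation of a solution vanishing at `0`, with
`s'' = -lam s`, `s 0 = 0`, `e'' = -lam e` and `s' e - s e' = 1`. -/
theorem eq_integral_green (h : SolvesSchrodinger q lam φ ψ) (h0 : φ 0 = 0) {e e' s s' : ℝ → ℂ}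
    (he : ∀ x, HasDerivAt e (e' x) x) (he' : ∀ x, HasDerivAt e' (-lam * e x) x)
    (hs : ∀ x, HasDerivAt s (s' x) x) (hs' : ∀ x, HasDerivAt s' (-lam * s x) x)
    (hs0 : s 0 = 0) (hwr : ∀ x, s' x * e x - s x * e' x = 1) {x R : ℝ} (hx : 0 ≤ x) (hxR : x ≤ R) :
    φ x = -(e x * ∫ y in (0)..x, q y * φ y * s y) - s x * (∫ y in x..R, q y * φ y * e y) -
      s x * (φ R * e' R - ψ R * e R) := by
  -- Lagrange's identity is applied with `s` on `[0, x]` and with `e` on `[x, R]`. The terms in `ψ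
  -- x` cancel, and those in `φ x` combine to the Wronskian of `s` and `e`.
  rw [h.integral_mul_eq_wronskian hs hs' le_rfl hx, h.integral_mul_eq_wronskian he he' hx hxR,
    h0, hs0]
  linear_combination (-φ x) * hwr x

/-- The Green representation with `e = exp (ikx)` and `s = sin (kx) / k`: since `|e| = exp (-κx)`
and `|s| ≤ ‖k‖⁻¹ exp (κx)` for `x ≥ 0`, the kernel decays like `exp (-κ|x - y|)` and the boundary
term like `exp (-κ(R - x))`. -/
theorem norm_le_integral_exp (h : SolvesSchrodinger q lam φ ψ) (h0 : φ 0 = 0) {k : ℂ}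
    (hk : k ^ 2 = lam) (hk0 : 0 < k.im) {x R : ℝ} (hx : 0 ≤ x) (hxR : x ≤ R)
    (hq : IntervalIntegrable q volume 0 R) :
    ‖φ x‖ ≤ ‖k‖⁻¹ * (∫ y in (0)..R, Real.exp (-(k.im * |x - y|)) * ‖q y‖ * ‖φ y‖) +
      Real.exp (-(k.im * (R - x))) * (‖φ R‖ + ‖k‖⁻¹ * ‖ψ R‖) := by
  have hkne : k ≠ 0 := by rintro rfl; simp at hk0
  set κ := k.im with hκ
  let e : ℝ → ℂ := fun x => Complex.exp (Complex.I * k * x)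
  let f : ℝ → ℂ := fun x => Complex.exp (-(Complex.I * k * x))
  have hlin : ∀ x : ℝ, HasDerivAt (fun x : ℝ => Complex.I * k * (x : ℂ)) (Complex.I * k) x := by
    intro x
    simpa using (Complex.ofRealCLM.hasDerivAt (x := x)).const_mul (Complex.I * k)
  have he : ∀ x, HasDerivAt e (Complex.I * k * e x) x := fun x =>
    (hlin x).cexp.congr_deriv (by simp only [e]; ring)
  have hf : ∀ x, HasDerivAt f (-(Complex.I * k * f x)) x := fun x =>
    (hlin x).neg.cexp.congr_deriv (by simp only [f, Pi.neg_apply]; ring)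
  have hne : ∀ x, ‖e x‖ = Real.exp (-(κ * x)) := by
    intro x; simp [e, Complex.norm_exp, hκ]
  have hnf : ∀ x, ‖f x‖ = Real.exp (κ * x) := by
    intro x; simp [f, Complex.norm_exp, hκ]
  have hef : ∀ x, e x * f x = 1 := by
    intro x; simp only [e, f, ← Complex.exp_add]; simp
  have hI : Complex.I * k ≠ 0 := mul_ne_zero Complex.I_ne_zero hkne
  let s : ℝ → ℂ := fun x => (e x - f x) / (2 * (Complex.I * k))
  let s' : ℝ → ℂ := fun x => (e x + f x) / 2
  have hns : ∀ y, 0 ≤ y → ‖s y‖ ≤ ‖k‖⁻¹ * Real.exp (κ * y) := by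
    intro y hy
    have h1 : Real.exp (-(κ * y)) ≤ Real.exp (κ * y) :=
      Real.exp_le_exp.2 (by nlinarith [mul_nonneg hk0.le hy])
    have h2 : ‖e y - f y‖ ≤ 2 * Real.exp (κ * y) := by
      refine (norm_sub_le _ _).trans ?_
      rw [hne, hnf]; linarith
    have h3 : 0 < ‖k‖ := norm_pos_iff.2 hkne
    simp only [s, norm_div, norm_mul, Complex.norm_I, Complex.norm_ofNat, one_mul]
    rw [div_le_iff₀ (by positivity)]
    field_simp
    linarith
  have hI2 : Complex.I * k * (Complex.I * k) = -lam := by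
    rw [← hk]; linear_combination k ^ 2 * Complex.I_mul_I
  have hgreen := h.eq_integral_green h0 he (e' := fun x => Complex.I * k * e x) (s := s) (s' := s')
    (fun x => ((he x).const_mul (Complex.I * k)).congr_deriv (by rw [← hI2]; ring))
    (fun x => (((he x).sub (hf x)).div_const _).congr_deriv (by
      simp only [s']; field_simp; ring))
    (fun x => (((he x).add (hf x)).div_const _).congr_deriv (by
      simp only [s]; rw [← hI2]; field_simp; ring))
    (by simp [s, e, f])
    (fun x => by
      simp only [s, s']
      field_simp
      linear_combination (2 : ℂ) * hef x) hx hxR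
  have hgi : IntervalIntegrable (fun y => Real.exp (-(κ * |x - y|)) * ‖q y‖ * ‖φ y‖) volume 0 R :=
    (hq.norm.continuousOn_mul (by fun_prop)).mul_continuousOn (by
      rw [uIcc_of_le (hx.trans hxR)]
      exact h.continuousOn.norm.mono Icc_subset_Ici_self)
  have hgi1 : IntervalIntegrable (fun y => Real.exp (-(κ * |x - y|)) * ‖q y‖ * ‖φ y‖) volume 0 x :=
    hgi.mono_set (by
      rw [uIcc_of_le hx, uIcc_of_le (hx.trans hxR)]; exact Icc_subset_Icc_right hxR)
  have hgi2 : IntervalIntegrable (fun y => Real.exp (-(κ * |x - y|)) * ‖q y‖ * ‖φ y‖) volume x R :=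
    hgi.mono_set (by
      rw [uIcc_of_le hxR, uIcc_of_le (hx.trans hxR)]; exact Icc_subset_Icc_left hx)
  have b1 : ‖e x * ∫ y in (0)..x, q y * φ y * s y‖ ≤
      ‖k‖⁻¹ * ∫ y in (0)..x, Real.exp (-(κ * |x - y|)) * ‖q y‖ * ‖φ y‖ := by
    rw [← intervalIntegral.integral_const_mul, ← intervalIntegral.integral_const_mul]
    refine intervalIntegral.norm_integral_le_of_norm_le hx (ae_of_all _ fun y hy => ?_)
      (hgi1.const_mul _)
    rw [norm_mul, norm_mul, norm_mul, hne, abs_of_nonneg (by linarith [hy.2])]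
    calc Real.exp (-(κ * x)) * (‖q y‖ * ‖φ y‖ * ‖s y‖)
        ≤ Real.exp (-(κ * x)) * (‖q y‖ * ‖φ y‖ * (‖k‖⁻¹ * Real.exp (κ * y))) := by
          gcongr; exact hns y hy.1.le
      _ = ‖k‖⁻¹ * ((Real.exp (-(κ * x)) * Real.exp (κ * y)) * ‖q y‖ * ‖φ y‖) := by ring
      _ = _ := by rw [← Real.exp_add]; ring_nf
  have b2 : ‖s x * ∫ y in x..R, q y * φ y * e y‖ ≤
      ‖k‖⁻¹ * ∫ y in x..R, Real.exp (-(κ * |x - y|)) * ‖q y‖ * ‖φ y‖ := by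
    rw [← intervalIntegral.integral_const_mul, ← intervalIntegral.integral_const_mul]
    refine intervalIntegral.norm_integral_le_of_norm_le hxR (ae_of_all _ fun y hy => ?_)
      (hgi2.const_mul _)
    rw [norm_mul, norm_mul, norm_mul, hne, abs_of_nonpos (by linarith [hy.1])]
    calc ‖s x‖ * (‖q y‖ * ‖φ y‖ * Real.exp (-(κ * y)))
        ≤ (‖k‖⁻¹ * Real.exp (κ * x)) * (‖q y‖ * ‖φ y‖ * Real.exp (-(κ * y))) := by
          gcongr; exact hns x hx
      _ = ‖k‖⁻¹ * ((Real.exp (κ * x) * Real.exp (-(κ * y))) * ‖q y‖ * ‖φ y‖) := by ring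
      _ = _ := by rw [← Real.exp_add]; ring_nf
  have b3 : ‖s x * (φ R * (Complex.I * k * e R) - ψ R * e R)‖ ≤
      Real.exp (-(κ * (R - x))) * (‖φ R‖ + ‖k‖⁻¹ * ‖ψ R‖) := by
    have h3 : 0 < ‖k‖ := norm_pos_iff.2 hkne
    rw [norm_mul]
    calc ‖s x‖ * ‖φ R * (Complex.I * k * e R) - ψ R * e R‖
        ≤ (‖k‖⁻¹ * Real.exp (κ * x)) *
          (‖φ R‖ * (‖k‖ * Real.exp (-(κ * R))) + ‖ψ R‖ * Real.exp (-(κ * R))) := by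
          gcongr
          · exact hns x hx
          · refine (norm_sub_le _ _).trans (le_of_eq ?_)
            simp [hne]
      _ = (Real.exp (κ * x) * Real.exp (-(κ * R))) * (‖φ R‖ + ‖k‖⁻¹ * ‖ψ R‖) := by
          field_simp
      _ = _ := by rw [← Real.exp_add]; ring_nf
  rw [← intervalIntegral.integral_add_adjacent_intervals hgi1 hgi2, mul_add]
  rw [hgreen]
  refine (norm_sub_le _ _).trans ?_
  refine add_le_add ((norm_sub_le _ _).trans ?_) b3
  rw [norm_neg]
  exact add_le_add b1 b2

end SolvesSchrodinger

/-! ### Boundedness from control on a relatively dense set. -/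

/-- If `φ'` varies on intervals of length `h` by at most a small multiple of `sup |φ|`, then
pointwise bounds for `φ` on a relatively dense set give uniform bounds for `φ` and `φ'`. -/
theorem exists_bound_of_relatively_dense {φ ψ : ℝ → ℂ} {h v m : ℝ} (hh : 0 < h) (hv : 0 ≤ v)
    (hvh : v * h ≤ 1 / 4) (hφ : ∀ x, 0 ≤ x → HasDerivWithinAt φ (ψ x) (Ici 0) x)
    (hψ : ∀ a S, 0 ≤ a → (∀ y ∈ Icc a (a + h), ‖φ y‖ ≤ S) →
      ∀ x ∈ Icc a (a + h), ‖ψ x - ψ a‖ ≤ S * v)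
    (hm : ∀ a, 0 ≤ a → ∃ y ∈ Icc a (a + h / 3), ‖φ y‖ ≤ m) :
    ∃ B, ∀ x, 0 ≤ x → ‖φ x‖ ≤ B ∧ ‖ψ x‖ ≤ B := by
  refine ⟨14 * m + 6 * m / h + 14 * m * v, fun a ha => ?_⟩
  have hsub : Icc a (a + h) ⊆ Ici 0 := fun x hx => ha.trans hx.1
  have hc : ContinuousOn φ (Icc a (a + h)) := fun x hx =>
    ((hφ x (hsub hx)).mono hsub).continuousWithinAt
  obtain ⟨x₀, hx₀, hmax⟩ := isCompact_Icc.exists_isMaxOn (nonempty_Icc.2 (by linarith)) hc.norm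
  set S := ‖φ x₀‖ with hS
  have hSb : ∀ y ∈ Icc a (a + h), ‖φ y‖ ≤ S := fun y hy => hmax hy
  -- Minus the linear function of slope `ψ a`, `φ` is Lipschitz on the window with constant `S * v`.
  have hg : ∀ x ∈ Icc a (a + h), ∀ y ∈ Icc a (a + h),
      ‖(φ y - ψ a * y) - (φ x - ψ a * x)‖ ≤ S * v * |y - x| := by
    intro x hx y hy
    have := (convex_Icc a (a + h)).norm_image_sub_le_of_norm_hasDerivWithin_le
      (f := fun y : ℝ => φ y - ψ a * y) (f' := fun y => ψ y - ψ a) (C := S * v)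
      (fun z hz => by
        refine (((hφ z (hsub hz)).mono hsub).sub
          ((Complex.ofRealCLM.hasDerivAt (x := z)).hasDerivWithinAt.const_mul (ψ a))).congr_deriv ?_
        simp) (fun z hz => hψ a S ha hSb z hz) hx hy
    simpa [Real.norm_eq_abs] using this
  -- Good points in the first and last thirds are at least `h / 3` apart, so the difference quotient
  -- of `φ` between them controls `ψ a`.
  obtain ⟨y₁, hy₁, hm₁⟩ := hm a ha
  obtain ⟨y₃, hy₃, hm₃⟩ := hm (a + 2 * h / 3) (by linarith)
  have hy₁' : y₁ ∈ Icc a (a + h) := ⟨hy₁.1, by linarith [hy₁.2]⟩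
  have hy₃' : y₃ ∈ Icc a (a + h) := ⟨by linarith [hy₃.1], by linarith [hy₃.2]⟩
  have hm0 : 0 ≤ m := (norm_nonneg _).trans hm₁
  have hS0 : 0 ≤ S := norm_nonneg _
  have hd : h / 3 ≤ y₃ - y₁ := by linarith [hy₁.2, hy₃.1]
  have hd0 : 0 < y₃ - y₁ := by linarith
  have h1 : ‖ψ a‖ * (y₃ - y₁) ≤ 2 * m + S * v * (y₃ - y₁) := by
    have h2 := hg y₁ hy₁' y₃ hy₃'
    rw [abs_of_pos hd0] at h2
    have h3 : ψ a * ((y₃ - y₁ : ℝ) : ℂ) =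
      φ y₃ - φ y₁ - ((φ y₃ - ψ a * y₃) - (φ y₁ - ψ a * y₁)) := by push_cast; ring
    have h4 : ‖ψ a * ((y₃ - y₁ : ℝ) : ℂ)‖ = ‖ψ a‖ * (y₃ - y₁) := by
      rw [norm_mul, Complex.norm_real, Real.norm_eq_abs, abs_of_pos hd0]
    rw [← h4, h3]
    refine (norm_sub_le _ _).trans ?_
    linarith [norm_sub_le (φ y₃) (φ y₁)]
  have h5 : ‖ψ a‖ ≤ 6 * m / h + S * v := by
    have h6 : (‖ψ a‖ - S * v) * (y₃ - y₁) ≤ 2 * m := by linarith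
    have h7 : ‖ψ a‖ - S * v ≤ 6 * m / h := by
      rw [le_div_iff₀ hh]
      by_cases h8 : 0 ≤ ‖ψ a‖ - S * v
      · nlinarith
      · nlinarith
    linarith
  -- Going from `y₁` to the maximum point gives `S ≤ 7m + 2S(vh)`; since `vh ≤ 1/4`, the last term
  -- is at most `S / 2` and is absorbed.
  have h9 : S ≤ 14 * m := by
    have h2 := hg y₁ hy₁' x₀ hx₀
    have hab : |x₀ - y₁| ≤ h := abs_le.2 ⟨by linarith [hx₀.1, hy₁'.2], by linarith [hx₀.2, hy₁'.1]⟩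
    have h3 : φ x₀ = φ y₁ + ψ a * ((x₀ - y₁ : ℝ) : ℂ) +
      ((φ x₀ - ψ a * x₀) - (φ y₁ - ψ a * y₁)) := by push_cast; ring
    have h4 : ‖ψ a * ((x₀ - y₁ : ℝ) : ℂ)‖ ≤ (6 * m / h + S * v) * h := by
      rw [norm_mul, Complex.norm_real, Real.norm_eq_abs]
      gcongr
    have h6 : S * v * |x₀ - y₁| ≤ S * v * h := by gcongr
    have h7 : S ≤ ‖φ y₁‖ + ‖ψ a * ((x₀ - y₁ : ℝ) : ℂ)‖ +
        ‖(φ x₀ - ψ a * x₀) - (φ y₁ - ψ a * y₁)‖ := by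
      rw [hS]; nth_rewrite 1 [h3]; exact norm_add₃_le
    have h8 : (6 * m / h + S * v) * h = 6 * m + S * (v * h) := by field_simp
    have h10 : S * (v * h) ≤ S * (1 / 4) := by gcongr
    nlinarith
  have h11 : 0 ≤ 6 * m / h := by positivity
  have h12 : 0 ≤ m * v := by positivity
  have h13 : S * v ≤ 14 * m * v := by gcongr
  exact ⟨by linarith [hSb a ⟨le_rfl, by linarith⟩], by linarith⟩

/-! ### Weak-type bounds on bounded intervals. -/

section WeakInterval

variable {r N t : ℝ} {q : ℝ → ℂ}

theorem setLIntegral_weight_mul_le_of_weak (hr : 1 < r) (hN : 0 ≤ N)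
    (hq : AEStronglyMeasurable q halfLine)
    (hw : ∀ s : ℝ, 0 < s → ENNReal.ofReal s ^ r * distribFun q s ≤ ENNReal.ofReal N)
    (ht : 0 < t) {w : ℝ → ℝ≥0∞} (hwm : Measurable w) (hw1 : ∀ x, w x ≤ 1) {a b : ℝ} (ha : 0 ≤ a) :
    ∫⁻ x in Ioc a b, w x * ‖q x‖ₑ ≤
      (∫⁻ x in Ioc a b, w x) * ENNReal.ofReal t +
        ENNReal.ofReal (N * (t ^ (1 - r) / (r - 1))) := by
  have h := lintegral_weight_mul_le_of_weak hr hN hq hw ht (w := (Ioc a b).indicator w)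
    (hwm.indicator measurableSet_Ioc)
    (fun x => (indicator_le_self' (fun _ _ => zero_le) x).trans (hw1 x))
  rw [lintegral_indicator measurableSet_Ioc] at h
  refine le_trans (le_of_eq ?_) h
  have h1 : ∀ x, (Ioc a b).indicator w x * ‖q x‖ₑ =
      (Ioc a b).indicator (fun x => w x * ‖q x‖ₑ) x := fun x => by
    by_cases hx : x ∈ Ioc a b <;> simp [hx]
  simp_rw [h1]
  rw [lintegral_indicator measurableSet_Ioc, Measure.restrict_restrict measurableSet_Ioc,
    inter_eq_left.2 (Ioc_subset_Ioi_self.trans (Ioi_subset_Ioi ha))]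

theorem intervalIntegrable_of_weak (hr : 1 < r) (hN : 0 ≤ N)
    (hq : AEStronglyMeasurable q halfLine)
    (hw : ∀ s : ℝ, 0 < s → ENNReal.ofReal s ^ r * distribFun q s ≤ ENNReal.ofReal N)
    {a b : ℝ} (ha : 0 ≤ a) (hab : a ≤ b) : IntervalIntegrable q volume a b := by
  rw [intervalIntegrable_iff_integrableOn_Ioc_of_le hab]
  refine ⟨hq.mono_measure (Measure.restrict_mono (Ioc_subset_Ioi_self.trans (Ioi_subset_Ioi ha)) le_rfl), ?_⟩
  have h := setLIntegral_weight_mul_le_of_weak hr hN hq hw one_pos (w := fun _ => 1)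
    measurable_const (fun _ => le_rfl) (a := a) (b := b) ha
  simp only [one_mul, lintegral_const, Measure.restrict_apply MeasurableSet.univ, univ_inter,
    Real.volume_Ioc] at h
  exact lt_of_le_of_lt h (ENNReal.add_lt_top.2
    ⟨ENNReal.mul_lt_top ENNReal.ofReal_lt_top ENNReal.ofReal_lt_top, ENNReal.ofReal_lt_top⟩)

theorem intervalIntegral_weight_mul_le_of_weak (hr : 1 < r) (hN : 0 ≤ N)
    (hq : AEStronglyMeasurable q halfLine)
    (hw : ∀ s : ℝ, 0 < s → ENNReal.ofReal s ^ r * distribFun q s ≤ ENNReal.ofReal N)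
    (ht : 0 < t) {w : ℝ → ℝ} (hwm : Measurable w) (hw0 : ∀ x, 0 ≤ w x) (hw1 : ∀ x, w x ≤ 1)
    {a b W : ℝ} (ha : 0 ≤ a) (hab : a ≤ b) (hW0 : 0 ≤ W)
    (hW : ∫⁻ x in Ioc a b, ENNReal.ofReal (w x) ≤ ENNReal.ofReal W) :
    ∫ x in a..b, w x * ‖q x‖ ≤ W * t + N * (t ^ (1 - r) / (r - 1)) := by
  have hpos : 0 ≤ N * (t ^ (1 - r) / (r - 1)) :=
    mul_nonneg hN (div_nonneg (Real.rpow_nonneg ht.le _) (by linarith))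
  have h := setLIntegral_weight_mul_le_of_weak hr hN hq hw ht (w := fun x => ENNReal.ofReal (w x))
    hwm.ennreal_ofReal (fun x => by simpa using hw1 x) (a := a) (b := b) ha
  have hqm : AEStronglyMeasurable q (volume.restrict (Ioc a b)) :=
    hq.mono_measure (Measure.restrict_mono (Ioc_subset_Ioi_self.trans (Ioi_subset_Ioi ha)) le_rfl)
  rw [intervalIntegral.integral_of_le hab, integral_eq_lintegral_of_nonneg_ae
    (ae_of_all _ fun x => mul_nonneg (hw0 x) (norm_nonneg _))
    (hwm.aestronglyMeasurable.mul hqm.norm)]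
  refine ENNReal.toReal_le_of_le_ofReal (by positivity) ?_
  rw [ENNReal.ofReal_add (by positivity) hpos, ENNReal.ofReal_mul hW0]
  simp_rw [fun x => ENNReal.ofReal_mul (q := ‖q x‖) (hw0 x), ofReal_norm]
  exact h.trans (by gcongr)

end WeakInterval

/-- Chebyshev: for large `m` the set where `|f| ≥ m` has measure less than `h`, so it cannot fill an
interval of length `h`. -/
theorem exists_norm_le_of_memLp {p : ℝ≥0∞} (hp0 : p ≠ 0) (hp : p ≠ ∞) {f : ℝ → ℂ}
    (hf : MemLp f p halfLine) {h : ℝ} (hh : 0 < h) :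
    ∃ m : ℝ, ∀ a, 0 ≤ a → ∃ y ∈ Icc a (a + h), ‖f y‖ ≤ m := by
  set c := eLpNorm f p halfLine ^ p.toReal with hc
  have hp' : 0 < p.toReal := ENNReal.toReal_pos hp0 hp
  have hcf : c ≠ ∞ := (ENNReal.rpow_lt_top_of_nonneg hp'.le hf.2.ne).ne
  obtain ⟨m, hm, hm0⟩ := (((tendsto_rpow_atTop hp').eventually
    (eventually_gt_atTop (c.toReal / h))).and (eventually_gt_atTop 0)).exists
  refine ⟨m, fun a ha => ?_⟩
  by_contra! hcon
  have h1 := mul_meas_ge_le_pow_eLpNorm' halfLine hp0 hp hf.1 (ENNReal.ofReal m)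
  have h2 : ENNReal.ofReal h ≤ halfLine {x | ENNReal.ofReal m ≤ ‖f x‖ₑ} := by
    calc ENNReal.ofReal h = halfLine (Ioc a (a + h)) := by
          rw [Measure.restrict_apply measurableSet_Ioc,
            inter_eq_left.2 (Ioc_subset_Ioi_self.trans (Ioi_subset_Ioi ha))]
          simp
      _ ≤ _ := measure_mono fun x hx => by
          show ENNReal.ofReal m ≤ ‖f x‖ₑ
          rw [← ofReal_norm]
          exact ENNReal.ofReal_le_ofReal (hcon x ⟨hx.1.le, hx.2⟩).le
  have h3 : ENNReal.ofReal (m ^ p.toReal * h) ≤ c := by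
    rw [ENNReal.ofReal_mul (by positivity), ← ENNReal.ofReal_rpow_of_pos hm0]
    exact (mul_le_mul_right h2 _).trans h1
  rw [ENNReal.ofReal_le_iff_le_toReal hcf] at h3
  rw [div_lt_iff₀ hh] at hm
  linarith

/-! ### Bounded solutions and the Birman–Schwinger inequality. -/

namespace SolvesSchrodinger

variable {q φ ψ : ℝ → ℂ} {lam : ℂ}

/-- Solutions in `L_p`, `0 < p < ∞`, are bounded together with their derivatives. -/
theorem exists_bound_of_memLp (h : SolvesSchrodinger q lam φ ψ) {p : ℝ≥0∞} (hp0 : p ≠ 0)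
    (hp : p ≠ ∞) (hφ : MemLp φ p halfLine) {r N : ℝ} (hr : 1 < r) (hN : 0 ≤ N)
    (hq : AEStronglyMeasurable q halfLine)
    (hw : ∀ s : ℝ, 0 < s → ENNReal.ofReal s ^ r * distribFun q s ≤ ENNReal.ofReal N) :
    ∃ B, ∀ x, 0 ≤ x → ‖φ x‖ ≤ B ∧ ‖ψ x‖ ≤ B := by
  -- `v` bounds the integral of `|q| + |lam|` over any interval of length at most `1`, by the
  -- weak-type estimate at level `t = 1`. The window length `1 / (4v) ≤ 1` then gives `v * h = 1/4`.
  set v : ℝ := 1 + N / (r - 1) + ‖lam‖ with hv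
  have hNr : 0 ≤ N / (r - 1) := div_nonneg hN (by linarith)
  have hv1 : 1 ≤ v := by linarith [norm_nonneg lam]
  have hh : 0 < 1 / (4 * v) := by positivity
  have hh1 : 1 / (4 * v) ≤ 1 := by rw [div_le_one (by positivity)]; linarith
  obtain ⟨m, hm⟩ := exists_norm_le_of_memLp hp0 hp hφ (div_pos hh three_pos)
  refine exists_bound_of_relatively_dense (v := v) hh (by linarith) (by field_simp; rfl)
    h.hasDeriv (fun a S ha hS x hx => ?_) hm
  have hS0 : 0 ≤ S := (norm_nonneg _).trans (hS a ⟨le_rfl, by linarith⟩)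
  have hqi := intervalIntegrable_of_weak hr hN hq hw ha hx.1
  have hqb : ∫ y in a..x, ‖q y‖ ≤ 1 + N / (r - 1) := by
    have := intervalIntegral_weight_mul_le_of_weak hr hN hq hw one_pos (w := fun _ => 1)
      measurable_const (fun _ => zero_le_one) (fun _ => le_rfl) ha hx.1 zero_le_one
      (by simp only [ENNReal.ofReal_one, lintegral_const, one_mul,
            Measure.restrict_apply MeasurableSet.univ, univ_inter, Real.volume_Ioc]
          rw [← ENNReal.ofReal_one]
          exact ENNReal.ofReal_le_ofReal (by linarith [hx.2]))
    simp only [one_mul, Real.one_rpow] at this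
    calc _ ≤ _ := this
      _ = _ := by ring
  rw [← h.integral_eq_sub ha hx.1]
  calc ‖∫ y in a..x, (q y - lam) * φ y‖ ≤ ∫ y in a..x, S * (‖q y‖ + ‖lam‖) := by
        refine intervalIntegral.norm_integral_le_of_norm_le hx.1 (ae_of_all _ fun y hy => ?_)
          ((hqi.norm.add intervalIntegrable_const).const_mul S)
        rw [norm_mul, mul_comm]
        exact mul_le_mul (hS y ⟨hy.1.le, hy.2.trans hx.2⟩) (norm_sub_le _ _) (norm_nonneg _) hS0
    _ = S * ((∫ y in a..x, ‖q y‖) + (x - a) * ‖lam‖) := by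
        rw [intervalIntegral.integral_const_mul,
          intervalIntegral.integral_add hqi.norm intervalIntegrable_const,
          intervalIntegral.integral_const, smul_eq_mul]
    _ ≤ S * v := by
        have h1 : (x - a) * ‖lam‖ ≤ 1 * ‖lam‖ := by gcongr; linarith [hx.2]
        gcongr
        linarith

/-- The Birman–Schwinger bound: the sup norm of the resolvent kernel against `|q|` is at least `1`
whenever there is a nontrivial `L_p` solution. -/
theorem one_le_of_memLp (h : SolvesSchrodinger q lam φ ψ) (h0 : φ 0 = 0) {p : ℝ≥0∞} (hp0 : p ≠ 0)
    (hp : p ≠ ∞) (hφ : MemLp φ p halfLine) {r N t : ℝ} (hr : 1 < r) (hN : 0 ≤ N)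
    (hq : AEStronglyMeasurable q halfLine)
    (hw : ∀ s : ℝ, 0 < s → ENNReal.ofReal s ^ r * distribFun q s ≤ ENNReal.ofReal N)
    {k : ℂ} (hk : k ^ 2 = lam) (hk0 : 0 < k.im) (hne : ∃ x, 0 < x ∧ φ x ≠ 0) (ht : 0 < t) :
    1 ≤ ‖k‖⁻¹ * (2 / k.im * t + N * (t ^ (1 - r) / (r - 1))) := by
  obtain ⟨B, hB⟩ := h.exists_bound_of_memLp hp0 hp hφ hr hN hq hw
  set K := 2 / k.im * t + N * (t ^ (1 - r) / (r - 1)) with hK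
  have hbdd : BddAbove (range fun x : Ici (0 : ℝ) => ‖φ x‖) :=
    ⟨B, by rintro _ ⟨x, rfl⟩; exact (hB x x.2).1⟩
  set S := ⨆ x : Ici (0 : ℝ), ‖φ x‖ with hS
  have hSb : ∀ x, 0 ≤ x → ‖φ x‖ ≤ S := fun x hx => le_ciSup hbdd (⟨x, hx⟩ : Ici (0 : ℝ))
  have hS0 : 0 < S := by
    obtain ⟨x, hx, hx'⟩ := hne
    exact (norm_pos_iff.2 hx').trans_le (hSb x hx.le)
  have hstep : ∀ x, 0 ≤ x → ‖φ x‖ ≤ ‖k‖⁻¹ * K * S := by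
    intro x hx
    have hR : ∀ R, x ≤ R →
        ‖φ x‖ ≤ ‖k‖⁻¹ * K * S + Real.exp (-(k.im * (R - x))) * (B + ‖k‖⁻¹ * B) := by
      intro R hxR
      have hR0 : 0 ≤ R := hx.trans hxR
      have hqi := intervalIntegrable_of_weak hr hN hq hw le_rfl hR0
      have hei : IntervalIntegrable (fun y => Real.exp (-(k.im * |x - y|)) * ‖q y‖) volume 0 R :=
        hqi.norm.continuousOn_mul (by fun_prop)
      have hint : ∫ y in (0)..R, Real.exp (-(k.im * |x - y|)) * ‖q y‖ * ‖φ y‖ ≤ K * S := by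
        calc ∫ y in (0)..R, Real.exp (-(k.im * |x - y|)) * ‖q y‖ * ‖φ y‖
            ≤ ∫ y in (0)..R, Real.exp (-(k.im * |x - y|)) * ‖q y‖ * S := by
              refine intervalIntegral.integral_mono_on hR0 ?_ (hei.mul_const S) fun y hy => ?_
              · refine hei.mul_continuousOn ?_
                rw [uIcc_of_le hR0]
                exact h.continuousOn.norm.mono Icc_subset_Ici_self
              · gcongr
                exact hSb y hy.1
          _ = (∫ y in (0)..R, Real.exp (-(k.im * |x - y|)) * ‖q y‖) * S :=
              intervalIntegral.integral_mul_const _ _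
          _ ≤ K * S := by
              gcongr
              refine intervalIntegral_weight_mul_le_of_weak hr hN hq hw ht (by fun_prop)
                (fun y => (Real.exp_pos _).le) (fun y => ?_) le_rfl hR0 (by positivity) ?_
              · exact Real.exp_le_one_iff.2 (neg_nonpos.2 (by positivity))
              · rw [← lintegral_exp_neg_mul_abs_sub hk0 x]
                exact setLIntegral_le_lintegral _ _
      refine (h.norm_le_integral_exp h0 hk hk0 hx hxR hqi).trans ?_
      rw [mul_assoc]
      gcongr
      · exact (hB R hR0).1
      · exact (hB R hR0).2
    have hlim : Tendsto
        (fun R => ‖k‖⁻¹ * K * S + Real.exp (-(k.im * (R - x))) * (B + ‖k‖⁻¹ * B)) atTop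
        (𝓝 (‖k‖⁻¹ * K * S + 0 * (B + ‖k‖⁻¹ * B))) := by
      refine tendsto_const_nhds.add (Tendsto.mul_const _ ?_)
      refine Real.tendsto_exp_neg_atTop_nhds_zero.comp ?_
      exact (tendsto_atTop_add_const_right _ (-x) tendsto_id).const_mul_atTop hk0
    have := ge_of_tendsto hlim ((eventually_ge_atTop x).mono hR)
    simpa using this
  -- Here `0 < S < ∞`, so the factor `‖k‖⁻¹ * K` cannot be below `1`.
  have hfin : S ≤ ‖k‖⁻¹ * K * S := ciSup_le fun x => hstep x x.2
  by_contra! hlt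
  nlinarith

end SolvesSchrodinger

/-! ### From eigenvalues to solutions, and the final estimate. -/

theorem exists_solvesSchrodinger_of_isEigenvalue {p : ℝ} {q : ℝ → ℂ} {lam : ℂ}
    (h : IsEigenvalue (schrodingerOp p q) lam) :
    ∃ φ ψ : ℝ → ℂ, SolvesSchrodinger q lam φ ψ ∧ φ 0 = 0 ∧
      MemLp φ (ENNReal.ofReal p) halfLine ∧ ∃ x, 0 < x ∧ φ x ≠ 0 := by
  obtain ⟨u, hu, hTu⟩ := h
  have hg := (schrodingerOp p q).mem_graph u
  rw [schrodingerOp_graph, hTu] at hg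
  obtain ⟨φ, ψ, hae, hs⟩ := hg
  refine ⟨φ, ψ, ⟨hs.hasDeriv, hs.absCont, ?_⟩, hs.boundary, (memLp_congr_ae hae).1 (Lp.memLp _), ?_⟩
  · filter_upwards [hs.equation, hae, Lp.coeFn_smul lam (u : Lp ℂ (ENNReal.ofReal p) halfLine)]
      with x hx hx1 hx2
    refine hx.congr_deriv ?_
    have hx1 : (u : Lp ℂ (ENNReal.ofReal p) halfLine) x = φ x := hx1
    change q x * φ x - (lam • (u : Lp ℂ (ENNReal.ofReal p) halfLine) : Lp ℂ _ halfLine) x = _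
    rw [hx2, Pi.smul_apply, hx1, smul_eq_mul]
    ring
  · by_contra! hcon
    refine hu ((Lp.eq_zero_iff_ae_eq_zero).2 ?_)
    filter_upwards [hae, ae_restrict_mem measurableSet_Ioi] with x hx hx0
    exact hx.trans (hcon x hx0)

theorem corollary5 (p γ θ : ℝ) (hp : 1 < p)
    (hγ₁ : p ≤ 2 → 1 < 2 * γ) (hγ₂ : 2 < p → p - 1 < 2 * γ)
    (hθ₀ : 0 < θ) (hθ₁ : θ < 2 * Real.pi) :
    ∃ C : ℝ, 0 < C ∧ ∀ q : ℝ → ℂ, MemWeakL (γ + 1 / 2) q →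
      ∀ lam : ℂ, (¬ ∃ x : ℝ, 0 ≤ x ∧ lam = (x : ℂ)) →
        lam = (‖lam‖ : ℂ) * Complex.exp ((θ : ℂ) * Complex.I) →
        IsEigenvalue (schrodingerOp p q) lam →
        ENNReal.ofReal (‖lam‖ ^ γ) ≤ ENNReal.ofReal C *
          ⨆ (t : ℝ) (_ : 0 < t), ENNReal.ofReal t ^ (γ + 1 / 2) * distribFun q t := by
  -- Both ranges of `p` give `γ + 1/2 > 1`, the exponent condition of the weak-type estimates.
  have hγ : 1 / 2 < γ := by
    rcases le_or_gt p 2 with h | h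
    · linarith [hγ₁ h]
    · linarith [hγ₂ h]
  set σ := Real.sin (θ / 2) with hσ
  have hσ0 : 0 < σ := Real.sin_pos_of_pos_of_lt_pi (by linarith) (by linarith)
  set A := (σ / 4) ^ (1 / 2 - γ) with hA
  have hA0 : 0 < A := Real.rpow_pos_of_pos (by linarith) _
  have hC0 : 0 < 2 * A / (γ - 1 / 2) := div_pos (by linarith) (by linarith)
  refine ⟨2 * A / (γ - 1 / 2), hC0, fun q hq lam hlam harg heig => ?_⟩
  set M := ⨆ (t : ℝ) (_ : 0 < t), ENNReal.ofReal t ^ (γ + 1 / 2) * distribFun q t with hM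
  rcases eq_or_ne M ∞ with hMt | hMt
  · rw [hMt, ENNReal.mul_top (by simpa using hC0)]
    exact le_top
  obtain ⟨φ, ψ, hs, h0, hφ, hne⟩ := exists_solvesSchrodinger_of_isEigenvalue heig
  have hlam0 : lam ≠ 0 := by
    rintro rfl
    exact hlam ⟨0, le_rfl, by simp⟩
  set L := ‖lam‖ with hL
  have hL0 : 0 < L := norm_pos_iff.2 hlam0
  -- As `θ / 2 ∈ (0, π)`, this square root of `lam` lies in the upper half-plane, with `k.im = √L *
  -- σ`.
  set k : ℂ := (√L : ℂ) * Complex.exp (((θ / 2 : ℝ) : ℂ) * Complex.I) with hk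
  have hsq : 0 < √L := Real.sqrt_pos.2 hL0
  have hk2 : k ^ 2 = lam := by
    rw [hk, mul_pow, ← Complex.ofReal_pow, Real.sq_sqrt hL0.le, ← Complex.exp_nat_mul, harg]
    congr 2
    push_cast; ring
  have hkn : ‖k‖ = √L := by
    rw [hk, norm_mul, Complex.norm_exp_ofReal_mul_I, mul_one, Complex.norm_real,
      Real.norm_of_nonneg hsq.le]
  have hki : k.im = √L * σ := by
    rw [hk, Complex.im_ofReal_mul, Complex.exp_ofReal_mul_I_im]
  have hMr : ENNReal.ofReal M.toReal = M := ENNReal.ofReal_toReal hMt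
  have hw : ∀ s : ℝ, 0 < s →
      ENNReal.ofReal s ^ (γ + 1 / 2) * distribFun q s ≤ ENNReal.ofReal M.toReal := by
    intro s h
    rw [hMr]
    exact le_iSup₂ (f := fun (t : ℝ) (_ : 0 < t) =>
      ENNReal.ofReal t ^ (γ + 1 / 2) * distribFun q t) s h
  -- The level `t = σ / 4 * L` makes `‖k‖⁻¹ * (2 / k.im) * t` equal to `1/2`, so the term carrying
  -- `M` must be at least `1/2`; the power of `σ / 4` in that term is `A`.
  have hmain := hs.one_le_of_memLp h0 (by simpa using by linarith) ENNReal.ofReal_ne_top hφ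
    (r := γ + 1 / 2) (t := σ / 4 * L) (by linarith) ENNReal.toReal_nonneg hq.1 hw hk2
    (by rw [hki]; positivity) hne (by positivity)
  rw [← hMr, ← ENNReal.ofReal_mul hC0.le]
  refine ENNReal.ofReal_le_ofReal ?_
  have hpow : L ^ γ = √L * L ^ (γ - 1 / 2) := by
    rw [Real.sqrt_eq_rpow, ← Real.rpow_add hL0]; ring_nf
  have hX : 0 < L ^ (γ - 1 / 2) := Real.rpow_pos_of_pos hL0 _
  have hLm : L ^ (1 / 2 - γ) = (L ^ (γ - 1 / 2))⁻¹ := by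
    rw [← Real.rpow_neg hL0.le]; ring_nf
  rw [hkn, hki, show 1 - (γ + 1 / 2) = 1 / 2 - γ by ring,
    show γ + 1 / 2 - 1 = γ - 1 / 2 by ring, Real.mul_rpow (by positivity) hL0.le, hLm, ← hA] at hmain
  have hg : 0 < γ - 1 / 2 := by linarith
  have hLs : L = √L * √L := (Real.mul_self_sqrt hL0.le).symm
  have h1 : (√L)⁻¹ * (2 / (√L * σ) * (σ / 4 * L)) = 1 / 2 := by
    rw [show σ / 4 * L = σ / 4 * (√L * √L) by rw [← hLs]]
    field_simp; norm_num
  rw [mul_add, h1] at hmain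
  rw [hpow]
  have h2 : (√L)⁻¹ * (M.toReal * (A * (L ^ (γ - 1 / 2))⁻¹ / (γ - 1 / 2))) =
      (2 * A / (γ - 1 / 2) * M.toReal) / (2 * (√L * L ^ (γ - 1 / 2))) := by
    field_simp
  have h3 : (1 : ℝ) / 2 ≤ (2 * A / (γ - 1 / 2) * M.toReal) / (2 * (√L * L ^ (γ - 1 / 2))) := by
    linarith
  rw [le_div_iff₀ (by positivity)] at h3
  linarith
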